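/- Let $k$ be a field with $\mathrm{char}(k) \ne 2$. For $a, b \in k$ put $c = -(a+b)$ and let $J_{(a,b)} \subset \mathbb{P}^3_k$ be the intersection of quadrics $$ a X_0^2 + X_1^2 = X_2^2, \qquad b X_0^2 + X_2^2 = X_3^2, \qquad c X_0^2 + X_3^2 = X_1^2, $$ which for $abc \ne 0$ is an elliptic curve with identity $(0:1:1:1)$. Let $E/k$ be an elliptic curve with base point $O$ and with a projectively normal embedding $E \hookrightarrow \mathbb{P}^3_k$ (that is, $k[X_0,\dots,X_3] \to \bigoplus_{n \ge 0} \Gamma(E, \mathcal{O}_E(n))$ is surjective) such that $\mathcal{O}_E(1) \cong \mathcal{L}(4(O))$. If $E(k)[2]$ is isomorphic to $(\mathbb{Z}/2\mathbb{Z})^2$, then there exists $(a,b) \in k^2$, with $a$, $b$ and $a+b$ all nonzero, such that $E$ is linearly isomorphic to $J_{(a,b)}$: there is a linear automorphism of $\mathbb{P}^3_k$, given by a matrix in $\mathrm{GL}_4(k)$, which maps $E$ isomorphically onto $J_{(a,b)}$ and $O$ to $(0:1:1:1)$. -/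

import Mathlib

open MvPolynomial in
/-- The automorphism `F(X₀, …, X₃) ↦ F(M X)` of the homogeneous coordinate ring of `ℙ³`
given by an invertible matrix `M`. -/
noncomputable def linSubst {k : Type*} [Field k] (M : GL (Fin 4) k) :
    MvPolynomial (Fin 4) k →ₐ[k] MvPolynomial (Fin 4) k :=
  MvPolynomial.aeval fun i => ∑ j, C (M.val i j) * X j

open MvPolynomial in
/-- The ideal of the Jacobi quadric intersection `J_{(a,b)}` in `ℙ³`, where `c = -(a + b)`:
`a X₀² + X₁² = X₂²`, `b X₀² + X₂² = X₃²`, `c X₀² + X₃² = X₁²`. -/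
noncomputable def jacobiIdeal {k : Type*} [Field k] (a b : k) : Ideal (MvPolynomial (Fin 4) k) :=
  Ideal.span
    {C a * X 0 ^ 2 + X 1 ^ 2 - X 2 ^ 2,
     C b * X 0 ^ 2 + X 2 ^ 2 - X 3 ^ 2,
     C (-(a + b)) * X 0 ^ 2 + X 3 ^ 2 - X 1 ^ 2}

/-- The identity `(0 : 1 : 1 : 1)` of `J_{(a,b)}`. -/
def jacobiIdentity (k : Type*) [Field k] : Fin 4 → k := ![0, 1, 1, 1]

/-- A place of a function field `K/k` of one variable: a nontrivial valuation ring of `K`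
containing `k`. These are the local rings of the closed points of the nonsingular projective
curve over `k` with function field `K`. -/
@[ext]
structure Place (k K : Type*) [Field k] [Field K] [Algebra k K] where
  ring : ValuationSubring K
  const_mem : ∀ c : k, algebraMap k K c ∈ ring
  ne_top : ring ≠ ⊤

namespace Place

variable {k K : Type*} [Field k] [Field K] [Algebra k K]

/-- A subsheaf of `𝒪`-modules of the constant sheaf `K`, given by its stalks
at the closed points. -/
abbrev Subsheaf (k K : Type*) [Field k] [Field K] [Algebra k K] : Type _ :=
  (P : Place k K) → Submodule P.ring K

/-- The invertible sheaf `ℒ(D)` of an effective divisor `D = ∑ D(P) P`: its stalk at `P` is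
`𝔪_P ^ (-D(P)) = {h ∈ K | h 𝔪_P ^ D(P) ⊆ 𝒪_P}`. -/
noncomputable def sheafOfDivisor (D : Place k K → ℕ) : Subsheaf k K := fun P =>
  1 / IsLocalization.coeSubmodule K (IsLocalRing.maximalIdeal P.ring ^ D P)

/-- Isomorphism of invertible subsheaves of `K`; every such isomorphism is the multiplication by
a nonzero rational function, as one sees at the generic point. -/
def Subsheaf.Isomorphic (L L' : Subsheaf k K) : Prop :=
  ∃ g : K, g ≠ 0 ∧ ∀ (P : Place k K) (h : K), h ∈ L P ↔ g * h ∈ L' P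

/-- A tuple `f` of rational functions, not all zero, is a morphism `(f₀ : f₁ : f₂ : f₃)` from the
curve to `ℙ³`. The pullback of `𝒪(1)` is the subsheaf of `K` generated by the `fᵢ`, which are the
pullbacks of the coordinates `Xᵢ`. -/
def pullbackO1 (f : Fin 4 → K) : Subsheaf k K := fun P => Submodule.span P.ring (Set.range f)

/-- Projective normality of the morphism given by `f`, with `ℒ` the pullback of `𝒪(1)`:
the map `k[X₀, …, X₃] → ⨁ₙ Γ(ℒⁿ)` is surjective. -/
def ProjectivelyNormal (k : Type*) {K : Type*} [Field k] [Field K] [Algebra k K]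
    (f : Fin 4 → K) : Prop :=
  ∀ (n : ℕ) (h : K), (∀ P : Place k K, h ∈ (pullbackO1 f P) ^ n) →
    ∃ F : MvPolynomial (Fin 4) k, F.IsHomogeneous n ∧ MvPolynomial.aeval f F = h

/-- The homogeneous ideal of the image in `ℙ³` of the curve under `f`. -/
noncomputable def imageIdeal (k : Type*) {K : Type*} [Field k] [Field K] [Algebra k K]
    (f : Fin 4 → K) : Ideal (MvPolynomial (Fin 4) k) :=
  Ideal.span {F | (∃ n : ℕ, F.IsHomogeneous n) ∧ MvPolynomial.aeval f F = 0}

/-- The morphism `f` to `ℙ³` takes the closed point `P` to the rational point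
`(c₀ : c₁ : c₂ : c₃)`: after multiplication by some `g ≠ 0` the `fᵢ` are regular at `P` and
take the values `cᵢ` there. -/
def MapsTo (f : Fin 4 → K) (P : Place k K) (c : Fin 4 → k) : Prop :=
  c ≠ 0 ∧ ∃ g : K, g ≠ 0 ∧ ∀ i, P.ring.valuation (g * f i - algebraMap k K (c i)) < 1

/-- The linear transform `M f` of a tuple `f`, that is the composition of the morphism to `ℙ³`
with the linear automorphism `x ↦ M x`. -/
noncomputable def linTransform (M : GL (Fin 4) k) (f : Fin 4 → K) : Fin 4 → K :=
  fun i => ∑ j, algebraMap k K (M.val i j) * f j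

end Place

namespace WeierstrassCurve

variable {k : Type*} [Field k] (W : WeierstrassCurve k)

/-- The coordinate function `x` of a Weierstrass curve. -/
noncomputable def coordX : W.toAffine.FunctionField :=
  algebraMap W.toAffine.CoordinateRing W.toAffine.FunctionField
    (Affine.CoordinateRing.mk W.toAffine (Polynomial.C Polynomial.X))

/-- The place is the base point `O` of the Weierstrass curve: the point at infinity, the only one
at which the function `x` has a pole. -/
def IsBasePoint (P : Place k W.toAffine.FunctionField) : Prop := W.coordX ∉ P.ring

open Classical in
/-- The divisor `n(O)`. -/
noncomputable def multO (n : ℕ) : Place k W.toAffine.FunctionField → ℕ :=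
  fun P => if W.IsBasePoint P then n else 0

/-- There is a place at which `x` has a pole. -/
theorem exists_isBasePoint : ∃ P : Place k W.toAffine.FunctionField, W.IsBasePoint P := by
  by_contra! hcon
  set K := W.toAffine.FunctionField
  have hx : W.coordX ∈ (⨅ V : {V : ValuationSubring K //
      Set.range (algebraMap k K) ⊆ V.toSubring}, V.1.toSubring) := by
    rw [Subring.mem_iInf]
    rintro ⟨V, hV⟩
    by_contra hxV
    refine hcon ⟨V, fun c => hV ⟨c, rfl⟩, ?_⟩ hxV
    rintro rfl
    exact hxV trivial
  rw [iInf_valuationSubring_superset] at hx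
  have hR : Subring.closure (Set.range (algebraMap k K)) = (algebraMap k K).range := by
    rw [← RingHom.coe_range, Subring.closure_eq]
  obtain ⟨p, hp, hp0⟩ : _root_.IsIntegral (Subring.closure (Set.range (algebraMap k K))) W.coordX := hx
  have hlift : p ∈ Polynomial.lifts ((algebraMap k K).codRestrict
      (Subring.closure (Set.range (algebraMap k K))) fun c => Subring.subset_closure ⟨c, rfl⟩) := by
    rw [Polynomial.lifts_iff_coeff_lifts]
    intro n
    obtain ⟨c, hc⟩ : (p.coeff n : K) ∈ (algebraMap k K).range := hR ▸ (p.coeff n).2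
    exact ⟨c, Subtype.ext hc⟩
  obtain ⟨q, hq, -, hqm⟩ := Polynomial.lifts_and_natDegree_eq_and_monic hlift hp
  have hq0 : Polynomial.aeval W.coordX q = 0 := by
    rw [← hq, Polynomial.eval₂_map] at hp0
    exact hp0
  have hq1 : algebraMap W.toAffine.CoordinateRing K
      (Affine.CoordinateRing.mk W.toAffine (Polynomial.C q)) = 0 := by
    rw [← hq0, coordX, Polynomial.aeval_algebraMap_apply]
    congr 1
    have h1 : ∀ r : Polynomial k, Affine.CoordinateRing.mk W.toAffine (Polynomial.C r) =
        algebraMap (Polynomial k) W.toAffine.CoordinateRing r := fun r => rfl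
    rw [h1, h1, Polynomial.aeval_algebraMap_apply, Polynomial.aeval_X_left_apply]
  have hq2 := (FaithfulSMul.algebraMap_injective _ _ (hq1.trans (map_zero _).symm))
  have := (Affine.CoordinateRing.smul_basis_eq_zero (W' := W.toAffine) (p := q) (q := 0)
    (by rw [Affine.CoordinateRing.smul, hq2]; simp)).1
  exact hqm.ne_zero this

end WeierstrassCurve

/-! ### Homogeneous ideals and linear changes of coordinates -/

namespace Place

variable {k K : Type*} [Field k] [Field K] [Algebra k K]

open MvPolynomial

/-! Since char k ≠ 2, completing the square turns full rational 2-torsion into an equation η² = (x -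
e₁)(x - e₂)(x - e₃) with distinct eᵢ in k. Put Yᵢ = (x - eᵢ)² - (eᵢ - eⱼ)(eᵢ - eₗ). Then Yᵢ + Yⱼ =
2(x - eᵢ)(x - eⱼ) and Yᵢ - Yⱼ = -2(eᵢ - eⱼ)(x - eₗ), so (eᵢ - eⱼ)(2η)² + Yᵢ² = Yⱼ². Thus (2η : Y₁ :
Y₂ : Y₃) satisfies the Jacobi equations with a = e₁ - e₂, b = e₂ - e₃, c = e₃ - e₁.

This tuple is an invertible linear transform of (1, x, η, x²), which is in turn one of `f` up to a
common factor: 1, x, η, x² are sections of ℒ(4(O)), so projective normality in degree 1 writes them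
as linear forms in `f`, and their independence makes the matrix invertible
(`exists_linTransform_eq`). Riemann-Roch is not needed.

For equality of ideals, `imageIdeal_eq_quarticIdeal` shows that two quadrics generate the ideal of
(1 : x : η : x²), and `comap_quarticIdeal` identifies their span with that of the Jacobi quadrics.
At O the pole of x² dominates in each Yᵢ and exceeds that of η, which gives (0 : 1 : 1 : 1) in
`mapsTo_jacobiIdentity`. -/

theorem aeval_mul_of_isHomogeneous {R S σ : Type*} [CommSemiring R] [CommSemiring S] [Algebra R S]
    (r : S) (f : σ → S) {F : MvPolynomial σ R} {n : ℕ} (hF : F.IsHomogeneous n) :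
    aeval (fun i => r * f i) F = r ^ n * aeval f F := by
  rw [aeval_def, aeval_def, eval₂_eq, eval₂_eq, Finset.mul_sum]
  refine Finset.sum_congr rfl fun d hd => ?_
  have h1 : ∑ i ∈ d.support, d i = n := by
    simpa [Finsupp.weight_apply, Finsupp.sum] using hF (mem_support_iff.1 hd)
  simp only [mul_pow, Finset.prod_mul_distrib, Finset.prod_pow_eq_pow_sum, h1]
  ring

/-- The cone over the morphism given by `f`: the homomorphism `F ↦ F(T f₀, …, T f₃)`. -/
noncomputable def coneHom (k : Type*) {K : Type*} [Field k] [Field K] [Algebra k K]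
    (f : Fin 4 → K) : MvPolynomial (Fin 4) k →ₐ[k] Polynomial K :=
  aeval fun i => Polynomial.X * Polynomial.C (f i)

theorem coneHom_of_isHomogeneous (f : Fin 4 → K) {F : MvPolynomial (Fin 4) k} {n : ℕ}
    (hF : F.IsHomogeneous n) :
    coneHom k f F = Polynomial.X ^ n * Polynomial.C (aeval f F) := by
  rw [coneHom, aeval_mul_of_isHomogeneous _ _ hF]
  congr 1
  have := congrArg (fun φ => φ F) (comp_aeval (R := k) (fun i => f i) (Polynomial.CAlgHom (R := k) (A := K)))
  simpa using this.symm

/-- The variable T records the degree, so F(T f) vanishes exactly when every homogeneous component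
of F vanishes at f. Membership in the ideal becomes a single equation. -/
theorem imageIdeal_eq_ker (f : Fin 4 → K) : imageIdeal k f = RingHom.ker (coneHom k f) := by
  apply le_antisymm
  · rw [imageIdeal, Ideal.span_le]
    rintro F ⟨⟨n, hn⟩, hF⟩
    simp [RingHom.mem_ker, coneHom_of_isHomogeneous f hn, hF]
  · intro F hF
    rw [RingHom.mem_ker] at hF
    rw [← sum_homogeneousComponent F]
    refine Ideal.sum_mem _ fun n hn => Ideal.subset_span
      ⟨⟨n, homogeneousComponent_isHomogeneous n F⟩, ?_⟩
    rw [← sum_homogeneousComponent F, map_sum] at hF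
    -- The coefficient of Tⁿ is the value at f of the component of degree n.
    have h := congrArg (fun p => Polynomial.coeff p n) hF
    simp only [coneHom_of_isHomogeneous f (homogeneousComponent_isHomogeneous _ F),
      Polynomial.finsetSum_coeff, Polynomial.coeff_X_pow_mul', Polynomial.coeff_zero] at h
    rw [Finset.sum_eq_single n] at h
    · simpa only [le_refl, if_true, Nat.sub_self, Polynomial.coeff_C_zero] using h
    · intro m _ hmn
      split_ifs with hle
      · exact Polynomial.coeff_C_of_ne_zero (by omega)
      · rfl
    · exact fun h => absurd hn h

theorem imageIdeal_mul {g : K} (hg : g ≠ 0) (f : Fin 4 → K) :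
    imageIdeal k (fun i => g * f i) = imageIdeal k f := by
  rw [imageIdeal, imageIdeal]
  congr 1
  ext F
  simp only [Set.mem_ofPred_eq]
  refine and_congr_right fun ⟨n, hn⟩ => ?_
  rw [aeval_mul_of_isHomogeneous _ _ hn]
  simp [hg]

theorem coneHom_comp_linSubst (M : GL (Fin 4) k) (f : Fin 4 → K) :
    (coneHom k f).comp (linSubst M) = coneHom k (linTransform M f) := by
  ext1 i
  simp only [coneHom, linSubst, linTransform, AlgHom.comp_apply, aeval_X, map_sum, map_mul,
    Finset.mul_sum, aeval_C]
  refine Finset.sum_congr rfl fun j _ => ?_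
  rw [Polynomial.algebraMap_apply]
  ring

theorem imageIdeal_linTransform (M : GL (Fin 4) k) (f : Fin 4 → K) :
    imageIdeal k (linTransform M f) = (imageIdeal k f).comap (linSubst M) := by
  ext F
  rw [imageIdeal_eq_ker, imageIdeal_eq_ker, Ideal.mem_comap, RingHom.mem_ker, RingHom.mem_ker,
    ← coneHom_comp_linSubst, AlgHom.comp_apply]

theorem linSubst_comp (M N : GL (Fin 4) k) :
    (linSubst M).comp (linSubst N) = linSubst (N * M) := by
  ext1 i
  simp only [linSubst, AlgHom.comp_apply, aeval_X, map_sum, map_mul, aeval_C, Units.val_mul,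
    Matrix.mul_apply, Finset.mul_sum, Finset.sum_mul, algebraMap_eq]
  rw [Finset.sum_comm]
  simp only [mul_assoc]

theorem linSubst_one : linSubst (1 : GL (Fin 4) k) = AlgHom.id k _ := by
  ext1 i
  simp [linSubst, Matrix.one_apply]

theorem linSubst_bijective (M : GL (Fin 4) k) : Function.Bijective (linSubst M) := by
  have h (N N' : GL (Fin 4) k) (h : N * N' = 1) (F) : linSubst N' (linSubst N F) = F := by
    rw [← AlgHom.comp_apply, linSubst_comp, h, linSubst_one, AlgHom.id_apply]
  exact Function.bijective_iff_has_inverse.2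
    ⟨linSubst M⁻¹, h _ _ (mul_inv_cancel M), h _ _ (inv_mul_cancel M)⟩

theorem linTransform_linTransform (M N : GL (Fin 4) k) (f : Fin 4 → K) :
    linTransform M (linTransform N f) = linTransform (M * N) f := by
  ext i
  simp only [linTransform, Units.val_mul, Matrix.mul_apply, Finset.mul_sum, map_sum, map_mul,
    Finset.sum_mul]
  rw [Finset.sum_comm]
  simp only [mul_assoc]

theorem linTransform_mul (M : GL (Fin 4) k) (g : K) (f : Fin 4 → K) :
    linTransform M (fun i => g * f i) = fun i => g * linTransform M f i := by
  ext i
  simp only [linTransform, Finset.mul_sum]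
  exact Finset.sum_congr rfl fun j _ => by ring

end Place

/-! ### The ideal of the quartic curve (1 : x : η : x²) -/

namespace Place

open MvPolynomial

variable {k K : Type*} [Field k] [Field K] [Algebra k K]

/-- The ideal of the quadric intersection `Z₁² = Z₀Z₃`, `Z₂² = Z₁Z₃ - s₁Z₀Z₃ + s₂Z₀Z₁ - s₃Z₀²`,
which contains the image of `(1 : x : η : x²)` when `η² = x³ - s₁x² + s₂x - s₃`. -/
noncomputable def quarticIdeal (s₁ s₂ s₃ : k) : Ideal (MvPolynomial (Fin 4) k) :=
  Ideal.span {X 1 ^ 2 - X 0 * X 3,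
    X 2 ^ 2 - (X 1 * X 3 - C s₁ * X 0 * X 3 + C s₂ * X 0 * X 1 - C s₃ * X 0 ^ 2)}

/-- Monomials that represent a basis of the quotient by `quarticIdeal`. -/
noncomputable def normalMonomial (k : Type*) [Field k] : ℕ × (ℕ ⊕ ℕ) → MvPolynomial (Fin 4) k
  | (i, .inl m) => X 0 ^ i * X 1 ^ (m % 2) * X 3 ^ (m / 2)
  | (i, .inr m) => X 0 ^ i * X 1 ^ (m % 2) * X 3 ^ (m / 2) * X 2

/-- The two quadrics rewrite X₁² and X₂², so the span of the normal monomials modulo the ideal is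
stable under multiplication by each variable; it contains 1, hence everything. -/
theorem exists_normalMonomial_sub_mem (s₁ s₂ s₃ : k) (F : MvPolynomial (Fin 4) k) :
    F ∈ Submodule.span k (Set.range (normalMonomial k)) ⊔
      (quarticIdeal s₁ s₂ s₃).restrictScalars k := by
  set I := quarticIdeal s₁ s₂ s₃
  set S := Submodule.span k (Set.range (normalMonomial k)) ⊔ I.restrictScalars k with hS
  have hI {a : MvPolynomial (Fin 4) k} (ha : a ∈ I) : a ∈ S := Submodule.mem_sup_right ha
  have hv (j) : normalMonomial k j ∈ S :=
    Submodule.mem_sup_left (Submodule.subset_span ⟨j, rfl⟩)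
  have hmul (p : MvPolynomial (Fin 4) k) (hp : ∀ j, normalMonomial k j * p ∈ S) (a)
      (ha : a ∈ S) : a * p ∈ S := by
    have : S ≤ S.comap (LinearMap.mulRight k p) := by
      conv_lhs => rw [hS]
      rw [sup_le_iff, Submodule.span_le]
      refine ⟨?_, fun b hb => hI (I.mul_mem_right p hb)⟩
      rintro _ ⟨j, rfl⟩
      exact hp j
    exact this ha
  have hq1 : X 1 ^ 2 - X 0 * X 3 ∈ I := Ideal.subset_span (by simp)
  have hq2 : X 2 ^ 2 - (X 1 * X 3 - C s₁ * X 0 * X 3 + C s₂ * X 0 * X 1 - C s₃ * X 0 ^ 2) ∈ I :=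
    Ideal.subset_span (by simp)
  have h0 := hmul (X 0) (by
    rintro ⟨i, m | m⟩
    · convert hv (i + 1, .inl m) using 1
      simp only [normalMonomial]; ring
    · convert hv (i + 1, .inr m) using 1
      simp only [normalMonomial]; ring)
  have h3 := hmul (X 3) (by
    rintro ⟨i, m | m⟩
    · convert hv (i, .inl (m + 2)) using 1
      simp only [normalMonomial, Nat.add_mod_right, Nat.add_div_right m two_pos]; ring
    · convert hv (i, .inr (m + 2)) using 1
      simp only [normalMonomial, Nat.add_mod_right, Nat.add_div_right m two_pos]; ring)
  have h1 := hmul (X 1) (by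
    rintro ⟨i, m⟩
    obtain ⟨m', hm'⟩ | ⟨m', hm'⟩ : (∃ m', Sum.elim id id m = 2 * m') ∨
        ∃ m', Sum.elim id id m = 2 * m' + 1 := by
      obtain ⟨m', h⟩ := Nat.even_or_odd' (Sum.elim id id m)
      exact h.imp (fun h => ⟨m', h⟩) fun h => ⟨m', h⟩
    · rcases m with m | m <;> obtain rfl : m = 2 * m' := hm'
      · convert hv (i, .inl (2 * m' + 1)) using 1
        have e1 : (2 * m' + 1) / 2 = m' := by omega
        have e2 : (2 * m') / 2 = m' := by omega
        have e3 : (2 * m' + 1) % 2 = 1 := by omega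
        have e4 : (2 * m') % 2 = 0 := by omega
        simp only [normalMonomial, e1, e2, e3, e4]; ring
      · convert hv (i, .inr (2 * m' + 1)) using 1
        have e1 : (2 * m' + 1) / 2 = m' := by omega
        have e2 : (2 * m') / 2 = m' := by omega
        have e3 : (2 * m' + 1) % 2 = 1 := by omega
        have e4 : (2 * m') % 2 = 0 := by omega
        simp only [normalMonomial, e1, e2, e3, e4]; ring
    · have e1 : (2 * m' + 1) / 2 = m' := by omega
      have e2 : (2 * m' + 2) / 2 = m' + 1 := by omega
      have e3 : (2 * m' + 1) % 2 = 1 := by omega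
      have e4 : (2 * m' + 2) % 2 = 0 := by omega
      rcases m with m | m <;> obtain rfl : m = 2 * m' + 1 := hm'
      · convert S.add_mem (hv (i + 1, .inl (2 * m' + 2)))
          (hI (I.mul_mem_left (X 0 ^ i * X 3 ^ m') hq1)) using 1
        simp only [normalMonomial, e1, e2, e3, e4]; ring
      · convert S.add_mem (hv (i + 1, .inr (2 * m' + 2)))
          (hI (I.mul_mem_left (X 0 ^ i * X 3 ^ m' * X 2) hq1)) using 1
        simp only [normalMonomial, e1, e2, e3, e4]; ring)
  have hC (c : k) (a) (ha : a ∈ S) : C c * a ∈ S := by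
    rw [← smul_eq_C_mul]; exact S.smul_mem c ha
  have h2 := hmul (X 2) (by
    rintro ⟨i, m | m⟩
    · exact hv (i, .inr m)
    · set a := normalMonomial k (i, .inl m) with ha
      have haS : a ∈ S := hv _
      convert S.add_mem (hI (I.mul_mem_left a hq2))
        (S.sub_mem (S.add_mem (S.sub_mem (h3 _ (h1 a haS)) (hC s₁ _ (h3 _ (h0 a haS))))
          (hC s₂ _ (h1 _ (h0 a haS)))) (hC s₃ _ (h0 _ (h0 a haS)))) using 1
      simp only [ha, normalMonomial]; ring)
  induction F using MvPolynomial.induction_on with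
  | C c =>
    rw [← mul_one (C c)]
    refine hC c _ ?_
    convert hv (0, .inl 0) using 1
    simp [normalMonomial]
  | add p q hp hq => exact S.add_mem hp hq
  | mul_X p i hp =>
    fin_cases i
    exacts [h0 _ hp, h1 _ hp, h2 _ hp, h3 _ hp]

/-- Normal monomials go to Tᵈ xᵐ or Tᵈ xᵐ η. Powers of T are independent over K, and the functions
xᵐ, xᵐ η are independent over k by `hinj`. -/
theorem linearIndependent_coneHom_normalMonomial {x η : K}
    (hinj : ∀ p q : Polynomial k, Polynomial.aeval x p + Polynomial.aeval x q * η = 0 →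
      p = 0 ∧ q = 0) :
    LinearIndependent k fun j => coneHom k ![1, x, η, x ^ 2] (normalMonomial k j) := by
  let L : Polynomial k × Polynomial k →ₗ[k] K :=
    (Polynomial.aeval x).toLinearMap.coprod
      ((LinearMap.mulRight k η).comp (Polynomial.aeval x).toLinearMap)
  have hL : LinearMap.ker L = ⊥ := by
    rw [LinearMap.ker_eq_bot']
    rintro ⟨p, q⟩ h
    obtain ⟨rfl, rfl⟩ := hinj p q h
    rfl
  have h1 := (((Polynomial.basisMonomials k).prod
    (Polynomial.basisMonomials k)).linearIndependent.map' L hL)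
  have h2 := Pi.linearIndependent_single (R := k) (η := ℕ) _ fun _ => h1
  -- The first entry is the T-degree. Once m is known it determines the exponent i of X₀, so
  -- distinct normal monomials have distinct images.
  let e : ℕ × (ℕ ⊕ ℕ) → Σ _ : ℕ, ℕ ⊕ ℕ := fun j =>
    ⟨j.1 + Sum.elim (fun m => m % 2 + m / 2) (fun m => m % 2 + m / 2 + 1) j.2, j.2⟩
  have he : Function.Injective e := by
    rintro ⟨i, m⟩ ⟨i', m'⟩ h
    simp only [e, Sigma.mk.injEq, heq_eq_eq] at h
    obtain ⟨h, rfl⟩ := h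
    rw [Nat.add_right_cancel h]
  have h3 := h2.comp e he
  refine LinearIndependent.of_comp
    (LinearMap.pi fun n => (Polynomial.lcoeff K n).restrictScalars k) ?_
  convert h3 using 1
  have hcoeff (n : ℕ) (c : K) :
      (fun d => (Polynomial.X ^ n * Polynomial.C c).coeff d) = Pi.single n c := by
    ext d
    rw [mul_comm, Polynomial.coeff_C_mul_X_pow, Pi.single_apply]
  have hx (m : ℕ) : (Polynomial.C x : Polynomial K) ^ (m % 2) * (Polynomial.C x ^ 2) ^ (m / 2) =
      Polynomial.C x ^ m := by
    rw [← pow_mul, ← pow_add, Nat.mod_add_div]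
  ext1 ⟨i, m⟩
  rcases m with m | m
  · have hn : coneHom k ![1, x, η, x ^ 2] (normalMonomial k (i, .inl m)) =
        Polynomial.X ^ (i + (m % 2 + m / 2)) * Polynomial.C (x ^ m) := by
      simp only [normalMonomial, coneHom, map_mul, map_pow, aeval_X]
      simp [← hx m]
      ring
    change (fun d => (coneHom k _ _).coeff d) = Pi.single (i + (m % 2 + m / 2)) _
    rw [hn, hcoeff]
    simp [L, e]
  · have hn : coneHom k ![1, x, η, x ^ 2] (normalMonomial k (i, .inr m)) =
        Polynomial.X ^ (i + (m % 2 + m / 2 + 1)) * Polynomial.C (x ^ m * η) := by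
      simp only [normalMonomial, coneHom, map_mul, map_pow, aeval_X]
      simp [← hx m]
      ring
    change (fun d => (coneHom k _ _).coeff d) = Pi.single (i + (m % 2 + m / 2 + 1)) _
    rw [hn, hcoeff]
    simp [L, e]

theorem imageIdeal_eq_quarticIdeal {x η : K} {s₁ s₂ s₃ : k}
    (heq : η ^ 2 = x ^ 3 - algebraMap k K s₁ * x ^ 2 + algebraMap k K s₂ * x - algebraMap k K s₃)
    (hinj : ∀ p q : Polynomial k, Polynomial.aeval x p + Polynomial.aeval x q * η = 0 →
      p = 0 ∧ q = 0) :
    imageIdeal k ![1, x, η, x ^ 2] = quarticIdeal s₁ s₂ s₃ := by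
  have hle : quarticIdeal s₁ s₂ s₃ ≤ imageIdeal k ![1, x, η, x ^ 2] := by
    rw [quarticIdeal, Ideal.span_le]
    rintro F (rfl | rfl)
    · refine Ideal.subset_span ⟨⟨2, ?_⟩, by simp⟩
      exact (isHomogeneous_X_pow _ _).sub ((isHomogeneous_X _ _).mul (isHomogeneous_X _ _))
    · refine Ideal.subset_span ⟨⟨2, ?_⟩, ?_⟩
      · have hX (i j : Fin 4) : (X i * X j : MvPolynomial (Fin 4) k).IsHomogeneous 2 :=
          (isHomogeneous_X _ _).mul (isHomogeneous_X _ _)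
        have hC (c : k) {F : MvPolynomial (Fin 4) k} (hF : F.IsHomogeneous 2) :
            (C c * F).IsHomogeneous 2 := by simpa using (isHomogeneous_C _ c).mul hF
        simp only [mul_assoc]
        exact (isHomogeneous_X_pow _ _).sub ((((hX _ _).sub (hC _ (hX _ _))).add
          (hC _ (hX _ _))).sub (hC _ (isHomogeneous_X_pow _ _)))
      · simp [heq]
        ring
  refine le_antisymm (fun F hF => ?_) hle
  -- The normal part s of F also lies in the kernel of the cone map, so independence forces s = 0.
  obtain ⟨s, hs, r, hr, rfl⟩ := Submodule.mem_sup.1 (exists_normalMonomial_sub_mem s₁ s₂ s₃ F)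
  replace hr : r ∈ quarticIdeal s₁ s₂ s₃ := hr
  have hs0 : s ∈ imageIdeal k ![1, x, η, x ^ 2] := by
    simpa using sub_mem hF (hle hr)
  rw [imageIdeal_eq_ker, RingHom.mem_ker] at hs0
  obtain ⟨c, rfl⟩ := (Finsupp.mem_span_range_iff_exists_finsupp).1 hs
  have hc : c = 0 := by
    refine linearIndependent_iff.1 (linearIndependent_coneHom_normalMonomial hinj) c ?_
    rw [← hs0, Finsupp.linearCombination_apply, Finsupp.sum, Finsupp.sum, map_sum]
    simp only [map_smul]
  simpa [hc] using hr
end Place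

/-! ### Jacobi coordinates on the quartic -/

namespace Place

open MvPolynomial

variable {k K : Type*} [Field k] [Field K] [Algebra k K]

/-- The linear forms `2η`, `(x - eᵢ)² - (eᵢ - eⱼ)(eᵢ - eₗ)` in `1, x, η, x²`. -/
def jacobiMatrix (e₁ e₂ e₃ : k) : Matrix (Fin 4) (Fin 4) k :=
  !![0, 0, 2, 0;
    e₁ * e₂ + e₁ * e₃ - e₂ * e₃, -2 * e₁, 0, 1;
    e₂ * e₃ + e₂ * e₁ - e₃ * e₁, -2 * e₂, 0, 1;
    e₃ * e₁ + e₃ * e₂ - e₁ * e₂, -2 * e₃, 0, 1]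

theorem det_jacobiMatrix (e₁ e₂ e₃ : k) :
    (jacobiMatrix e₁ e₂ e₃).det = 8 * (e₁ - e₂) * (e₂ - e₃) * (e₁ - e₃) := by
  simp [jacobiMatrix, Matrix.det_succ_row_zero, Fin.sum_univ_succ, Fin.succAbove]
  ring

/-- Each Jacobi quadric pulls back to a nonzero multiple of a member Q2 + (eᵢ + eⱼ) Q1 of the
pencil, and two distinct members span the pencil. -/
theorem comap_quarticIdeal {e₁ e₂ e₃ : k} (hk : (2 : k) ≠ 0) (h₁₂ : e₁ - e₂ ≠ 0)
    (h₂₃ : e₂ - e₃ ≠ 0) (h₁₃ : e₁ - e₃ ≠ 0) (N : GL (Fin 4) k) (hN : N.val = jacobiMatrix e₁ e₂ e₃) :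
    (quarticIdeal (e₁ + e₂ + e₃) (e₁ * e₂ + e₁ * e₃ + e₂ * e₃) (e₁ * e₂ * e₃)).comap
      (linSubst N) = jacobiIdeal (e₁ - e₂) (e₂ - e₃) := by
  suffices h : quarticIdeal (e₁ + e₂ + e₃) (e₁ * e₂ + e₁ * e₃ + e₂ * e₃) (e₁ * e₂ * e₃) =
      (jacobiIdeal (e₁ - e₂) (e₂ - e₃)).map (linSubst N) by
    rw [h, Ideal.comap_map_of_bijective _ (linSubst_bijective N)]
  have hX0 : linSubst N (X 0) = C 2 * X 2 := by
    simp [linSubst, hN, jacobiMatrix, Fin.sum_univ_four]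
  have hX1 : linSubst N (X 1) =
      C (e₁ * e₂ + e₁ * e₃ - e₂ * e₃) * X 0 + C (-2 * e₁) * X 1 + X 3 := by
    simp [linSubst, hN, jacobiMatrix, Fin.sum_univ_four]
  have hX2 : linSubst N (X 2) =
      C (e₂ * e₃ + e₂ * e₁ - e₃ * e₁) * X 0 + C (-2 * e₂) * X 1 + X 3 := by
    simp [linSubst, hN, jacobiMatrix, Fin.sum_univ_four]
  have hX3 : linSubst N (X 3) =
      C (e₃ * e₁ + e₃ * e₂ - e₁ * e₂) * X 0 + C (-2 * e₃) * X 1 + X 3 := by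
    simp [linSubst, hN, jacobiMatrix, Fin.sum_univ_four]
  have hCC (c : k) : linSubst N (C c) = C c := by simp [linSubst, algebraMap_eq]
  set Q1 : MvPolynomial (Fin 4) k := X 1 ^ 2 - X 0 * X 3 with hQ1
  set Q2 : MvPolynomial (Fin 4) k := X 2 ^ 2 - (X 1 * X 3 - C (e₁ + e₂ + e₃) * X 0 * X 3 +
    C (e₁ * e₂ + e₁ * e₃ + e₂ * e₃) * X 0 * X 1 - C (e₁ * e₂ * e₃) * X 0 ^ 2) with hQ2
  have ha : linSubst N (C (e₁ - e₂) * X 0 ^ 2 + X 1 ^ 2 - X 2 ^ 2) =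
      C (4 * (e₁ - e₂)) * (Q2 + C (e₁ + e₂) * Q1) := by
    simp only [map_add, map_sub, map_mul, map_pow, hX0, hX1, hX2, hCC, hQ1, hQ2, map_neg, map_ofNat]
    ring
  have hb : linSubst N (C (e₂ - e₃) * X 0 ^ 2 + X 2 ^ 2 - X 3 ^ 2) =
      C (4 * (e₂ - e₃)) * (Q2 + C (e₂ + e₃) * Q1) := by
    simp only [map_add, map_sub, map_mul, map_pow, hX0, hX2, hX3, hCC, hQ1, hQ2, map_neg, map_ofNat]
    ring
  have hc : linSubst N (C (-(e₁ - e₂ + (e₂ - e₃))) * X 0 ^ 2 + X 3 ^ 2 - X 1 ^ 2) =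
      C (4 * (e₃ - e₁)) * (Q2 + C (e₁ + e₃) * Q1) := by
    simp only [map_add, map_sub, map_mul, map_pow, hX0, hX1, hX3, hCC, hQ1, hQ2, map_neg, map_ofNat]
    ring
  have h4 : (4 : k) ≠ 0 := by
    rw [show (4 : k) = 2 * 2 by norm_num]; exact mul_ne_zero hk hk
  rw [jacobiIdeal, Ideal.map_span, quarticIdeal, ← hQ1, ← hQ2]
  simp only [Set.image_insert_eq, Set.image_singleton, ha, hb, hc]
  apply le_antisymm
  · set J : Ideal (MvPolynomial (Fin 4) k) := Ideal.span
      {C (4 * (e₁ - e₂)) * (Q2 + C (e₁ + e₂) * Q1), C (4 * (e₂ - e₃)) * (Q2 + C (e₂ + e₃) * Q1),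
        C (4 * (e₃ - e₁)) * (Q2 + C (e₁ + e₃) * Q1)}
    have hunit {c : k} (hc : c ≠ 0) {F : MvPolynomial (Fin 4) k} (hF : C c * F ∈ J) : F ∈ J := by
      have := J.mul_mem_left (C c⁻¹) hF
      rwa [← mul_assoc, ← C_mul, inv_mul_cancel₀ hc, C_1, one_mul] at this
    have h1 : Q2 + C (e₁ + e₂) * Q1 ∈ J :=
      hunit (mul_ne_zero h4 h₁₂) (Ideal.subset_span (by simp))
    have h2 : Q2 + C (e₂ + e₃) * Q1 ∈ J :=
      hunit (mul_ne_zero h4 h₂₃) (Ideal.subset_span (by simp))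
    -- The difference of the two members is (e₁ - e₃) Q1.
    have hJ1 : Q1 ∈ J := by
      refine hunit h₁₃ ?_
      convert J.sub_mem h1 h2 using 1
      simp only [map_sub, map_add]; ring
    have hJ2 : Q2 ∈ J := by
      convert J.sub_mem h1 (J.mul_mem_left (C (e₁ + e₂)) hJ1) using 1
      ring
    rw [Ideal.span_le]
    rintro F (rfl | rfl)
    exacts [hJ1, hJ2]
  · have h1 : Q1 ∈ Ideal.span {Q1, Q2} := Ideal.subset_span (by simp)
    have h2 : Q2 ∈ Ideal.span {Q1, Q2} := Ideal.subset_span (by simp)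
    rw [Ideal.span_le]
    rintro F (rfl | rfl | rfl) <;>
    exact Ideal.mul_mem_left _ _ (add_mem h2 (Ideal.mul_mem_left _ _ h1))

theorem linTransform_jacobiMatrix {e₁ e₂ e₃ : k} {N : GL (Fin 4) k}
    (hN : N.val = jacobiMatrix e₁ e₂ e₃) (x η : K) :
    linTransform N ![1, x, η, x ^ 2] =
      ![2 * η,
        x ^ 2 - 2 * algebraMap k K e₁ * x + algebraMap k K (e₁ * e₂ + e₁ * e₃ - e₂ * e₃),
        x ^ 2 - 2 * algebraMap k K e₂ * x + algebraMap k K (e₂ * e₃ + e₂ * e₁ - e₃ * e₁),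
        x ^ 2 - 2 * algebraMap k K e₃ * x + algebraMap k K (e₃ * e₁ + e₃ * e₂ - e₁ * e₂)] := by
  have h2 : algebraMap k K 2 = 2 := map_ofNat _ 2
  ext i
  fin_cases i <;> simp [linTransform, hN, jacobiMatrix, Fin.sum_univ_four, h2] <;> ring

end Place

/-! ### Valuations at the poles of x -/

namespace Place

variable {k K : Type*} [Field k] [Field K] [Algebra k K] (P : Place k K)

theorem valuation_algebraMap {c : k} (hc : c ≠ 0) : P.ring.valuation (algebraMap k K c) = 1 := by
  refine le_antisymm ((P.ring.valuation_le_one_iff _).2 (P.const_mem c)) ?_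
  have := (P.ring.valuation_le_one_iff _).2 (P.const_mem c⁻¹)
  rw [map_inv₀, map_inv₀] at this
  exact (inv_le_one₀ (by simp [zero_lt_iff, hc])).1 this

/-- Nonzero constants have valuation 1 and x has valuation greater than 1, so the leading term
strictly dominates. -/
theorem valuation_aeval {x : K} (hx : x ∉ P.ring) {p : Polynomial k} (hp : p ≠ 0) :
    P.ring.valuation (Polynomial.aeval x p) = P.ring.valuation x ^ p.natDegree := by
  have hx1 : 1 < P.ring.valuation x := by
    rw [← not_le, P.ring.valuation_le_one_iff]; exact hx
  rw [Polynomial.aeval_eq_sum_range, Finset.sum_range_succ]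
  have htop : P.ring.valuation (p.coeff p.natDegree • x ^ p.natDegree) =
      P.ring.valuation x ^ p.natDegree := by
    rw [Algebra.smul_def, map_mul, map_pow, P.valuation_algebraMap (by simpa using hp), one_mul]
  rw [Valuation.map_add_eq_of_lt_right, htop]
  rw [htop]
  refine Valuation.map_sum_lt _ (pow_ne_zero _ (zero_lt_one.trans hx1).ne') fun i hi => ?_
  rw [Algebra.smul_def, map_mul, map_pow]
  calc _ ≤ 1 * P.ring.valuation x ^ i :=
        mul_le_mul_left ((P.ring.valuation_le_one_iff _).2 (P.const_mem _)) _
    _ < _ := by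
      rw [one_mul]
      exact pow_lt_pow_right₀ hx1 (Finset.mem_range.1 hi)

variable {x η : K} {s₁ s₂ s₃ : k}

theorem mem_of_sq_eq
    (heq : η ^ 2 = x ^ 3 - algebraMap k K s₁ * x ^ 2 + algebraMap k K s₂ * x - algebraMap k K s₃)
    (hx : x ∈ P.ring) : η ∈ P.ring := by
  rw [← P.ring.valuation_le_one_iff, ← pow_le_one_iff_of_nonneg zero_le two_ne_zero, ← map_pow, heq,
    P.ring.valuation_le_one_iff]
  exact sub_mem (add_mem (sub_mem (pow_mem hx _) (mul_mem (P.const_mem _) (pow_mem hx _)))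
    (mul_mem (P.const_mem _) hx)) (P.const_mem _)

theorem valuation_sq
    (heq : η ^ 2 = x ^ 3 - algebraMap k K s₁ * x ^ 2 + algebraMap k K s₂ * x - algebraMap k K s₃)
    (hx : x ∉ P.ring) : P.ring.valuation η ^ 2 = P.ring.valuation x ^ 3 := by
  set p : Polynomial k := Polynomial.X ^ 3 - Polynomial.C s₁ * Polynomial.X ^ 2 +
    Polynomial.C s₂ * Polynomial.X - Polynomial.C s₃ with hp
  have hdeg : p.natDegree = 3 := by rw [hp]; compute_degree!
  have hp0 : p ≠ 0 := by rintro h; simp [h] at hdeg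
  have := P.valuation_aeval hx hp0
  rw [hdeg] at this
  rw [← this, ← map_pow, heq]
  simp [hp]

/-- At a pole of `x` the function `x / η` generates the value group. -/
theorem exists_uniformizer
    (heq : η ^ 2 = x ^ 3 - algebraMap k K s₁ * x ^ 2 + algebraMap k K s₂ * x - algebraMap k K s₃)
    (hfrac : ∀ z : K, ∃ p q p' q' : Polynomial k, z =
      (Polynomial.aeval x p + Polynomial.aeval x q * η) /
        (Polynomial.aeval x p' + Polynomial.aeval x q' * η))
    (hx : x ∉ P.ring) :
    ∃ u : K, 0 < P.ring.valuation u ∧ P.ring.valuation u < 1 ∧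
      P.ring.valuation x = P.ring.valuation u ^ (-2 : ℤ) ∧
      P.ring.valuation η = P.ring.valuation u ^ (-3 : ℤ) ∧
      ∀ z : K, z ≠ 0 → ∃ n : ℤ, P.ring.valuation z = P.ring.valuation u ^ n := by
  have hx1 : 1 < P.ring.valuation x := by
    rw [← not_le, P.ring.valuation_le_one_iff]; exact hx
  have hsq := P.valuation_sq heq hx
  have hx0 : P.ring.valuation x ≠ 0 := (zero_lt_one.trans hx1).ne'
  have hη0 : P.ring.valuation η ≠ 0 := by
    intro h
    rw [h, zero_pow two_ne_zero] at hsq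
    exact pow_ne_zero 3 hx0 hsq.symm
  -- As v(η)² = v(x)³, the poles of x and η have orders 2 and 3 relative to x / η.
  refine ⟨x / η, ?_⟩
  set w := P.ring.valuation (x / η) with hw
  have hwdiv : w = P.ring.valuation x / P.ring.valuation η := map_div₀ _ _ _
  have hw0 : w ≠ 0 := by rw [hwdiv]; exact div_ne_zero hx0 hη0
  have hw2 : w ^ 2 = (P.ring.valuation x)⁻¹ := by
    rw [hwdiv, div_pow, hsq]
    field_simp
  have hxw : P.ring.valuation x = w ^ (-2 : ℤ) := by
    rw [zpow_neg, zpow_ofNat, hw2, inv_inv]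
  have hηw : P.ring.valuation η = w ^ (-3 : ℤ) := by
    have h1 : P.ring.valuation η = P.ring.valuation x / w := by
      rw [hwdiv]; field_simp
    rw [h1, hxw, div_eq_mul_inv, ← zpow_neg_one, ← zpow_add₀ hw0]
    norm_num
  have hw1 : w < 1 := by
    rw [← pow_lt_one_iff_of_nonneg zero_le two_ne_zero, hw2]
    exact inv_lt_one_of_one_lt₀ hx1
  have hwpos : 0 < w := zero_lt_iff.2 hw0
  have hpoly (p : Polynomial k) (hp : p ≠ 0) :
      P.ring.valuation (Polynomial.aeval x p) = w ^ (-2 * (p.natDegree : ℤ)) := by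
    rw [P.valuation_aeval hx hp, hxw, zpow_mul, zpow_natCast]
  have hpair (p q : Polynomial k) (h : Polynomial.aeval x p + Polynomial.aeval x q * η ≠ 0) :
      ∃ n : ℤ, P.ring.valuation (Polynomial.aeval x p + Polynomial.aeval x q * η) = w ^ n := by
    have hq' (hq : q ≠ 0) : P.ring.valuation (Polynomial.aeval x q * η) =
        w ^ (-2 * (q.natDegree : ℤ) - 3) := by
      rw [map_mul, hpoly q hq, hηw, ← zpow_add₀ hw0, sub_eq_add_neg]
    by_cases hp : p = 0
    · have hq : q ≠ 0 := by rintro rfl; simp [hp] at h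
      exact ⟨_, by rw [hp, map_zero, zero_add, hq' hq]⟩
    by_cases hq : q = 0
    · exact ⟨_, by rw [hq, map_zero, zero_mul, add_zero, hpoly p hp]⟩
    rw [Valuation.map_add_of_distinct_val]
    · rcases max_choice (P.ring.valuation (Polynomial.aeval x p))
        (P.ring.valuation (Polynomial.aeval x q * η)) with hm | hm <;> rw [hm]
      exacts [⟨_, hpoly p hp⟩, ⟨_, hq' hq⟩]
    -- The exponents have opposite parity, so the two terms cannot cancel.
    · rw [hpoly p hp, hq' hq, Ne, zpow_right_inj₀ hwpos hw1.ne]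
      omega
  refine ⟨hwpos, hw1, hxw, hηw, fun z hz => ?_⟩
  obtain ⟨p, q, p', q', rfl⟩ := hfrac z
  rw [div_ne_zero_iff] at hz
  obtain ⟨n, hn⟩ := hpair p q hz.1
  obtain ⟨m, hm⟩ := hpair p' q' hz.2
  exact ⟨n - m, by rw [map_div₀, hn, hm, zpow_sub₀ hw0]⟩

theorem mem_sheafOfDivisor_of_mem (D : Place k K → ℕ) {h : K} (hh : h ∈ P.ring) :
    h ∈ sheafOfDivisor D P := by
  rw [sheafOfDivisor, Submodule.mem_div_iff_forall_mul_mem]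
  intro y hy
  obtain ⟨t, -, rfl⟩ := (IsLocalization.mem_coeSubmodule _ _).1 hy
  exact Submodule.mem_one.2 ⟨⟨h, hh⟩ * t, map_mul _ _ _⟩

theorem mem_sheafOfDivisor (D : Place k K → ℕ) {u h : K} (hu0 : 0 < P.ring.valuation u)
    (hu1 : P.ring.valuation u < 1)
    (hu : ∀ z : K, z ≠ 0 → ∃ n : ℤ, P.ring.valuation z = P.ring.valuation u ^ n)
    (hh : P.ring.valuation h ≤ P.ring.valuation u ^ (-(D P : ℤ))) :
    h ∈ sheafOfDivisor D P := by
  have huP : u ∈ P.ring := (P.ring.valuation_le_one_iff _).1 hu1.le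
  -- All values are integral powers of v(u), so a value below 1 is at most v(u): u generates the
  -- maximal ideal.
  have hm : IsLocalRing.maximalIdeal P.ring ≤ Ideal.span {⟨u, huP⟩} := by
    intro t ht
    rw [P.ring.valuation_lt_one_iff] at ht
    have hle : P.ring.valuation t ≤ P.ring.valuation u := by
      by_cases ht0 : (t : K) = 0
      · simp [ht0]
      · obtain ⟨n, hn⟩ := hu t ht0
        rw [hn] at ht ⊢
        rw [← zpow_zero (P.ring.valuation u), zpow_lt_zpow_iff_right_of_lt_one₀ hu0 hu1] at ht
        conv_rhs => rw [← zpow_one (P.ring.valuation u)]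
        exact (zpow_le_zpow_iff_right_of_lt_one₀ hu0 hu1).2 (by omega)
    have hu' : u ≠ 0 := by rintro rfl; simp at hu0
    have htu : (t : K) / u ∈ P.ring := by
      rw [← P.ring.valuation_le_one_iff, map_div₀]
      exact div_le_one_of_le₀ hle zero_le
    exact Ideal.mem_span_singleton'.2 ⟨⟨_, htu⟩, Subtype.ext (div_mul_cancel₀ _ hu')⟩
  rw [sheafOfDivisor, Submodule.mem_div_iff_forall_mul_mem]
  intro y hy
  obtain ⟨t, ht, rfl⟩ := (IsLocalization.mem_coeSubmodule _ _).1 hy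
  have ht' := Ideal.pow_right_mono hm (D P) ht
  rw [Ideal.span_singleton_pow, Ideal.mem_span_singleton'] at ht'
  obtain ⟨s, rfl⟩ := ht'
  refine Submodule.mem_one.2 ⟨⟨h * (s * u ^ D P), ?_⟩, rfl⟩
  rw [← P.ring.valuation_le_one_iff, map_mul, map_mul, map_pow]
  calc _ ≤ P.ring.valuation u ^ (-(D P : ℤ)) * (1 * P.ring.valuation u ^ D P) :=
        mul_le_mul' hh (mul_le_mul' (P.ring.valuation_le_one s) le_rfl)
    _ = 1 := by
      rw [one_mul, zpow_neg, zpow_natCast]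
      exact inv_mul_cancel₀ (pow_ne_zero _ hu0.ne')

end Place

/-! ### The Weierstrass function field and rational 2-torsion -/

namespace WeierstrassCurve

variable {k : Type*} [Field k] (W : WeierstrassCurve k)

/-- The coordinate function `y` of a Weierstrass curve. -/
noncomputable def coordY : W.toAffine.FunctionField :=
  algebraMap W.toAffine.CoordinateRing W.toAffine.FunctionField
    (Affine.CoordinateRing.mk W.toAffine Polynomial.X)

/-- The function `y + (a₁ x + a₃) / 2`, which changes its sign under the inversion. -/
noncomputable def coordEta : W.toAffine.FunctionField :=
  W.coordY + algebraMap k _ (W.a₁ / 2) * W.coordX + algebraMap k _ (W.a₃ / 2)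

theorem aeval_coordX (p : Polynomial k) : Polynomial.aeval W.coordX p =
    algebraMap W.toAffine.CoordinateRing W.toAffine.FunctionField
      (Affine.CoordinateRing.mk W.toAffine (Polynomial.C p)) := by
  rw [coordX, Polynomial.aeval_algebraMap_apply]
  congr 1
  have h1 : ∀ r : Polynomial k, Affine.CoordinateRing.mk W.toAffine (Polynomial.C r) =
      algebraMap (Polynomial k) W.toAffine.CoordinateRing r := fun r => rfl
  rw [h1, h1, Polynomial.aeval_algebraMap_apply, Polynomial.aeval_X_left_apply]

theorem aeval_coordX_add_mul_coordY (p q : Polynomial k) :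
    Polynomial.aeval W.coordX p + Polynomial.aeval W.coordX q * W.coordY =
      algebraMap W.toAffine.CoordinateRing W.toAffine.FunctionField
        (p • (1 : W.toAffine.CoordinateRing) + q • Affine.CoordinateRing.mk W.toAffine Polynomial.X) := by
  rw [aeval_coordX, aeval_coordX, coordY, Affine.CoordinateRing.smul, Affine.CoordinateRing.smul,
    mul_one, map_add, map_mul]

theorem aeval_coordX_add_mul_coordEta (p q : Polynomial k) :
    Polynomial.aeval W.coordX p + Polynomial.aeval W.coordX q * W.coordEta =
      Polynomial.aeval W.coordX (p + q * (Polynomial.C (W.a₁ / 2) * Polynomial.X +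
        Polynomial.C (W.a₃ / 2))) + Polynomial.aeval W.coordX q * W.coordY := by
  simp only [coordEta, map_add, map_mul, Polynomial.aeval_C, Polynomial.aeval_X]
  ring

theorem eq_zero_of_aeval_coordX_add_mul_coordEta {p q : Polynomial k}
    (h : Polynomial.aeval W.coordX p + Polynomial.aeval W.coordX q * W.coordEta = 0) :
    p = 0 ∧ q = 0 := by
  rw [aeval_coordX_add_mul_coordEta, aeval_coordX_add_mul_coordY] at h
  obtain ⟨hp, rfl⟩ := Affine.CoordinateRing.smul_basis_eq_zero
    (FaithfulSMul.algebraMap_injective _ _ (h.trans (map_zero _).symm))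
  simpa using hp

theorem exists_eq_div_coordEta (z : W.toAffine.FunctionField) : ∃ p q p' q' : Polynomial k, z =
    (Polynomial.aeval W.coordX p + Polynomial.aeval W.coordX q * W.coordEta) /
      (Polynomial.aeval W.coordX p' + Polynomial.aeval W.coordX q' * W.coordEta) := by
  have key (r : W.toAffine.CoordinateRing) : ∃ p q : Polynomial k,
      algebraMap _ W.toAffine.FunctionField r =
        Polynomial.aeval W.coordX p + Polynomial.aeval W.coordX q * W.coordEta := by
    obtain ⟨p, q, rfl⟩ := Affine.CoordinateRing.exists_smul_basis_eq r
    refine ⟨p - q * (Polynomial.C (W.a₁ / 2) * Polynomial.X + Polynomial.C (W.a₃ / 2)), q, ?_⟩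
    rw [aeval_coordX_add_mul_coordEta, sub_add_cancel, aeval_coordX_add_mul_coordY]
  obtain ⟨a, b, -, rfl⟩ := IsFractionRing.div_surjective (A := W.toAffine.CoordinateRing) z
  obtain ⟨p, q, h⟩ := key a
  obtain ⟨p', q', h'⟩ := key b
  exact ⟨p, q, p', q', by rw [h, h']⟩

theorem coordY_equation : W.coordY ^ 2 + algebraMap k _ W.a₁ * W.coordX * W.coordY +
    algebraMap k _ W.a₃ * W.coordY = W.coordX ^ 3 + algebraMap k _ W.a₂ * W.coordX ^ 2 +
      algebraMap k _ W.a₄ * W.coordX + algebraMap k _ W.a₆ := by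
  have h : algebraMap W.toAffine.CoordinateRing W.toAffine.FunctionField
      (Affine.CoordinateRing.mk W.toAffine W.toAffine.polynomial) = 0 := by
    rw [Affine.CoordinateRing.mk, AdjoinRoot.mk_self, map_zero]
  have hC (c : k) : algebraMap k W.toAffine.FunctionField c =
      algebraMap W.toAffine.CoordinateRing W.toAffine.FunctionField
        (Affine.CoordinateRing.mk W.toAffine (Polynomial.C (Polynomial.C c))) := by
    rw [← aeval_coordX, Polynomial.aeval_C]

  simp only [WeierstrassCurve.Affine.polynomial, map_add, map_sub, map_mul, map_pow, ← hC] at h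
  rw [← sub_eq_zero, ← h, coordX, coordY]
  ring

theorem coordEta_sq (hk : (2 : k) ≠ 0) : W.coordEta ^ 2 = W.coordX ^ 3 +
    algebraMap k _ (W.b₂ / 4) * W.coordX ^ 2 + algebraMap k _ (W.b₄ / 2) * W.coordX +
      algebraMap k _ (W.b₆ / 4) := by
  have h := W.coordY_equation
  have h4 : (4 : k) = 2 * 2 := by norm_num
  have h1 : W.a₁ = 2 * (W.a₁ / 2) := by field_simp
  have h3 : W.a₃ = 2 * (W.a₃ / 2) := by field_simp
  have hb2 : W.b₂ / 4 = W.a₂ + (W.a₁ / 2) ^ 2 := by rw [b₂, h4]; field_simp; ring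
  have hb4 : W.b₄ / 2 = W.a₄ + 2 * (W.a₁ / 2) * (W.a₃ / 2) := by rw [b₄]; field_simp
  have hb6 : W.b₆ / 4 = W.a₆ + (W.a₃ / 2) ^ 2 := by rw [b₆, h4]; field_simp; ring
  rw [h1, h3] at h
  rw [coordEta, hb2, hb4, hb6]
  have h2 : algebraMap k W.toAffine.FunctionField 2 = 2 := map_ofNat _ 2
  simp only [map_add, map_mul, map_pow, h2] at h ⊢
  linear_combination h

theorem exists_of_two_nsmul_eq_zero [DecidableEq k] {Q : W.toAffine.Point} (hQ0 : Q ≠ 0)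
    (hQ : 2 • Q = 0) : ∃ x y, ∃ h : W.toAffine.Nonsingular x y, Q = .some x y h ∧
      2 * y + W.a₁ * x + W.a₃ = 0 ∧ 4 * x ^ 3 + W.b₂ * x ^ 2 + 2 * W.b₄ * x + W.b₆ = 0 := by
  rcases Q with _ | ⟨x, y, h⟩
  · exact absurd rfl hQ0
  rw [two_nsmul] at hQ
  have hneg := eq_neg_of_add_eq_zero_left hQ
  rw [Affine.Point.neg_some, Affine.Point.some.injEq, Affine.negY] at hneg
  have hy : 2 * y + W.a₁ * x + W.a₃ = 0 := by linear_combination hneg.2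
  refine ⟨x, y, h, rfl, hy, ?_⟩
  have heq := (Affine.equation_iff _ _).1 h.1
  rw [b₂, b₄, b₆]
  linear_combination (2 * y + W.a₁ * x + W.a₃) * hy - 4 * heq

/-- The x-coordinates of the three nonzero 2-torsion points are roots of 4x³ + b₂x² + 2b₄x + b₆.
They are distinct because 2y + a₁x + a₃ = 0 determines y from x when 2 ≠ 0. -/
theorem exists_roots_of_two_torsion [DecidableEq k] (hk : (2 : k) ≠ 0)
    (h2 : Nonempty (AddSubgroup.torsionBy W.toAffine.Point 2 ≃+ ZMod 2 × ZMod 2)) :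
    ∃ e₁ e₂ e₃ : k, e₁ - e₂ ≠ 0 ∧ e₂ - e₃ ≠ 0 ∧ e₁ - e₃ ≠ 0 ∧
      W.coordEta ^ 2 = W.coordX ^ 3 - algebraMap k _ (e₁ + e₂ + e₃) * W.coordX ^ 2 +
        algebraMap k _ (e₁ * e₂ + e₁ * e₃ + e₂ * e₃) * W.coordX -
          algebraMap k _ (e₁ * e₂ * e₃) := by
  obtain ⟨φ⟩ := h2
  have key (t : ZMod 2 × ZMod 2) (ht : t ≠ 0) : ∃ x y,
      ∃ h : W.toAffine.Nonsingular x y, (φ.symm t : W.toAffine.Point) = .some x y h ∧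
      2 * y + W.a₁ * x + W.a₃ = 0 ∧ 4 * x ^ 3 + W.b₂ * x ^ 2 + 2 * W.b₄ * x + W.b₆ = 0 := by
    apply W.exists_of_two_nsmul_eq_zero
    · intro h
      exact ht (φ.symm.map_eq_zero_iff.1 (Subtype.ext h))
    · have := congrArg Subtype.val (AddSubgroup.torsionBy.nsmul (n := 2) (φ.symm t))
      exact this
  obtain ⟨e₁, y₁, n₁, hQ₁, hy₁, hr₁⟩ := key (1, 0) (by decide)
  obtain ⟨e₂, y₂, n₂, hQ₂, hy₂, hr₂⟩ := key (0, 1) (by decide)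
  obtain ⟨e₃, y₃, n₃, hQ₃, hy₃, hr₃⟩ := key (1, 1) (by decide)
  have hne {t t' : ZMod 2 × ZMod 2} (htt : t ≠ t') {x y x' y' : k} {h : W.toAffine.Nonsingular x y}
      {h' : W.toAffine.Nonsingular x' y'} (ht : (φ.symm t : W.toAffine.Point) = .some x y h)
      (ht' : (φ.symm t' : W.toAffine.Point) = .some x' y' h')
      (hy : 2 * y + W.a₁ * x + W.a₃ = 0) (hy' : 2 * y' + W.a₁ * x' + W.a₃ = 0) : x - x' ≠ 0 := by
    intro hx
    obtain rfl : x = x' := sub_eq_zero.1 hx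
    obtain rfl : y = y' := mul_left_cancel₀ hk (by linear_combination hy - hy')
    exact htt (φ.symm.injective (Subtype.ext (ht.trans ht'.symm)))
  have h₁₂ := hne (by decide) hQ₁ hQ₂ hy₁ hy₂
  have h₂₃ := hne (by decide) hQ₂ hQ₃ hy₂ hy₃
  have h₁₃ := hne (by decide) hQ₁ hQ₃ hy₁ hy₃
  have h4 : (4 : k) ≠ 0 := by
    rw [show (4 : k) = 2 * 2 by norm_num]; exact mul_ne_zero hk hk
  -- Divided differences of the cubic at its distinct roots yield Vieta's formulas.
  have d₁₂ : 4 * (e₁ ^ 2 + e₁ * e₂ + e₂ ^ 2) + W.b₂ * (e₁ + e₂) + 2 * W.b₄ = 0 :=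
    mul_left_cancel₀ h₁₂ (by linear_combination hr₁ - hr₂)
  have d₁₃ : 4 * (e₁ ^ 2 + e₁ * e₃ + e₃ ^ 2) + W.b₂ * (e₁ + e₃) + 2 * W.b₄ = 0 :=
    mul_left_cancel₀ h₁₃ (by linear_combination hr₁ - hr₃)
  have hb₂ : 4 * (e₁ + e₂ + e₃) + W.b₂ = 0 :=
    mul_left_cancel₀ h₂₃ (by linear_combination d₁₂ - d₁₃)
  have hb₄ : W.b₄ = 2 * (e₁ * e₂ + e₁ * e₃ + e₂ * e₃) :=
    mul_left_cancel₀ hk (by linear_combination d₁₂ - (e₁ + e₂) * hb₂)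
  have hb₆ : W.b₆ = -(4 * (e₁ * e₂ * e₃)) := by
    linear_combination hr₁ - e₁ ^ 2 * hb₂ - 2 * e₁ * hb₄
  refine ⟨e₁, e₂, e₃, h₁₂, h₂₃, h₁₃, ?_⟩
  have h2' : W.b₂ / 4 = -(e₁ + e₂ + e₃) := by
    rw [div_eq_iff h4]; linear_combination hb₂
  have h4' : W.b₄ / 2 = e₁ * e₂ + e₁ * e₃ + e₂ * e₃ := by
    rw [div_eq_iff hk]; linear_combination hb₄
  have h6' : W.b₆ / 4 = -(e₁ * e₂ * e₃) := by
    rw [div_eq_iff h4]; linear_combination hb₆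
  rw [W.coordEta_sq hk, h2', h4', h6', map_neg, map_neg]
  ring

end WeierstrassCurve

/-! ### Sections of ℒ(4(O)) as linear forms -/

namespace Place

open MvPolynomial

variable {k K : Type*} [Field k] [Field K] [Algebra k K]

theorem exists_aeval_eq_sum_of_isHomogeneous_one (f : Fin 4 → K) {F : MvPolynomial (Fin 4) k}
    (hF : F.IsHomogeneous 1) : ∃ c : Fin 4 → k, aeval f F = ∑ j, algebraMap k K (c j) * f j := by
  have h : F ∈ homogeneousSubmodule (Fin 4) k 1 := hF
  rw [homogeneousSubmodule_one_eq_span_X] at h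
  obtain ⟨c, rfl⟩ := (Submodule.mem_span_range_iff_exists_fun k).1 h
  exact ⟨c, by simp [Algebra.smul_def]⟩

end Place

namespace WeierstrassCurve

variable {k : Type*} [Field k] (W : WeierstrassCurve k)

theorem mem_sheafOfDivisor_multO {s₁ s₂ s₃ : k}
    (heq : W.coordEta ^ 2 = W.coordX ^ 3 - algebraMap k _ s₁ * W.coordX ^ 2 +
      algebraMap k _ s₂ * W.coordX - algebraMap k _ s₃)
    (P : Place k W.toAffine.FunctionField) (i : Fin 4) :
    ![1, W.coordX, W.coordEta, W.coordX ^ 2] i ∈ Place.sheafOfDivisor (W.multO 4) P := by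
  by_cases hP : W.IsBasePoint P
  · obtain ⟨u, hu0, hu1, hx, hη, hu⟩ := P.exists_uniformizer heq W.exists_eq_div_coordEta hP
    refine P.mem_sheafOfDivisor _ hu0 hu1 hu ?_
    have hD : W.multO 4 P = 4 := if_pos hP
    rw [hD]
    have hle {n : ℤ} (hn : -4 ≤ n) :
        P.ring.valuation u ^ n ≤ P.ring.valuation u ^ (-((4 : ℕ) : ℤ)) :=
      (zpow_le_zpow_iff_right_of_lt_one₀ hu0 hu1).2 hn
    fin_cases i
    · simpa using hle (n := 0) (by norm_num)
    · exact hx.trans_le (hle (by norm_num))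
    · exact hη.trans_le (hle (by norm_num))
    · change P.ring.valuation (W.coordX ^ 2) ≤ _
      rw [map_pow, hx, ← zpow_natCast, ← zpow_mul]
      exact hle (by norm_num)
  · refine P.mem_sheafOfDivisor_of_mem _ ?_
    have hx : W.coordX ∈ P.ring := not_not.1 hP
    fin_cases i
    exacts [one_mem _, hx, P.mem_of_sq_eq heq hx, pow_mem hx 2]

/-- The complete linear system `|4(O)|` is embedded by `1, x, η, x²`, up to a linear
automorphism. -/
theorem exists_linTransform_eq (f : Fin 4 → W.toAffine.FunctionField)
    (hf : Place.ProjectivelyNormal k f) {g : W.toAffine.FunctionField} (hg0 : g ≠ 0)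
    (hg : ∀ (P : Place k W.toAffine.FunctionField) (h : W.toAffine.FunctionField),
      h ∈ Place.pullbackO1 f P ↔ g * h ∈ Place.sheafOfDivisor (W.multO 4) P)
    {s₁ s₂ s₃ : k} (heq : W.coordEta ^ 2 = W.coordX ^ 3 - algebraMap k _ s₁ * W.coordX ^ 2 +
      algebraMap k _ s₂ * W.coordX - algebraMap k _ s₃) :
    ∃ B : GL (Fin 4) k, Place.linTransform B f =
      fun i => g⁻¹ * ![1, W.coordX, W.coordEta, W.coordX ^ 2] i := by
  have hrow (i : Fin 4) : ∃ c : Fin 4 → k,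
      g⁻¹ * ![1, W.coordX, W.coordEta, W.coordX ^ 2] i = ∑ j, algebraMap k _ (c j) * f j := by
    obtain ⟨F, hF, hFe⟩ := hf 1 (g⁻¹ * ![1, W.coordX, W.coordEta, W.coordX ^ 2] i) fun P => by
      rw [pow_one, hg, mul_inv_cancel_left₀ hg0]
      exact W.mem_sheafOfDivisor_multO heq P i
    rw [← hFe]
    exact Place.exists_aeval_eq_sum_of_isHomogeneous_one f hF
  choose B hB using hrow
  -- A linear relation between the rows would be a k-linear relation between 1, x, η, x².
  have hdet : (Matrix.of B).det ≠ 0 := by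
    intro h
    obtain ⟨v, hv0, hv⟩ := Matrix.exists_vecMul_eq_zero_iff.2 h
    have hsum : ∑ i, algebraMap k _ (v i) * ![1, W.coordX, W.coordEta, W.coordX ^ 2] i = 0 := by
      refine mul_left_cancel₀ (inv_ne_zero hg0) ?_
      rw [mul_zero, Finset.mul_sum]
      calc _ = ∑ i, ∑ j, algebraMap k _ (v i * B i j) * f j := by
            refine Finset.sum_congr rfl fun i _ => ?_
            rw [mul_left_comm, hB, Finset.mul_sum]
            exact Finset.sum_congr rfl fun j _ => by rw [map_mul, mul_assoc]
        _ = ∑ j, algebraMap k _ (Matrix.vecMul v (Matrix.of B) j) * f j := by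
            rw [Finset.sum_comm]
            refine Finset.sum_congr rfl fun j _ => ?_
            rw [← Finset.sum_mul, ← map_sum]
            rfl
        _ = 0 := by simp [hv]
    obtain ⟨hp, hq⟩ := W.eq_zero_of_aeval_coordX_add_mul_coordEta
      (p := Polynomial.C (v 0) + Polynomial.C (v 1) * Polynomial.X +
        Polynomial.C (v 3) * Polynomial.X ^ 2) (q := Polynomial.C (v 2)) (by
        rw [← hsum]
        simp [Fin.sum_univ_four]
        ring)
    apply hv0
    ext i
    have hc (n : ℕ) := congrArg (fun r => Polynomial.coeff r n) hp
    fin_cases i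
    · simpa using hc 0
    · simpa [Polynomial.coeff_X, Polynomial.coeff_C] using hc 1
    · simpa using hq
    · simpa [Polynomial.coeff_X, Polynomial.coeff_C] using hc 2
  refine ⟨Matrix.GeneralLinearGroup.mkOfDetNeZero (Matrix.of B) hdet, ?_⟩
  ext i
  rw [hB]
  rfl

end WeierstrassCurve

/-! ### The image of the base point, and the conclusion -/

namespace Place

variable {k K : Type*} [Field k] [Field K] [Algebra k K]

theorem mapsTo_jacobiIdentity (P : Place k K) {x η : K} {s₁ s₂ s₃ : k}
    (heq : η ^ 2 = x ^ 3 - algebraMap k K s₁ * x ^ 2 + algebraMap k K s₂ * x - algebraMap k K s₃)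
    (hx : x ∉ P.ring) {N : GL (Fin 4) k} {e₁ e₂ e₃ : k} (hN : N.val = jacobiMatrix e₁ e₂ e₃)
    {g : K} (hg : g ≠ 0) :
    MapsTo (linTransform N fun i => g * ![1, x, η, x ^ 2] i) P (jacobiIdentity k) := by
  have hx1 : 1 < P.ring.valuation x := by
    rw [← not_le, P.ring.valuation_le_one_iff]; exact hx
  have hx0 : x ≠ 0 := by rintro rfl; simp at hx1
  have hinv : P.ring.valuation x⁻¹ < 1 := by
    rw [map_inv₀]; exact inv_lt_one_of_one_lt₀ hx1
  have hmul {c z : K} (hc : c ∈ P.ring) (hz : P.ring.valuation z < 1) :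
      P.ring.valuation (c * z) < 1 := by
    rw [map_mul]
    exact (mul_le_of_le_one_left' ((P.ring.valuation_le_one_iff _).2 hc)).trans_lt hz
  have h2 : (2 : K) ∈ P.ring := map_ofNat (algebraMap k K) 2 ▸ P.const_mem 2
  -- Dividing by g x² turns each Yᵢ into 1 plus terms vanishing at the pole of x.
  refine ⟨fun h => one_ne_zero (congrFun h 1), x⁻¹ ^ 2 * g⁻¹,
    mul_ne_zero (pow_ne_zero _ (inv_ne_zero hx0)) (inv_ne_zero hg), fun i => ?_⟩
  rw [linTransform_mul, linTransform_jacobiMatrix hN]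
  have hcoord (e c : k) : P.ring.valuation (x⁻¹ ^ 2 * g⁻¹ *
      (g * (x ^ 2 - 2 * algebraMap k K e * x + algebraMap k K c)) - algebraMap k K 1) < 1 := by
    have : x⁻¹ ^ 2 * g⁻¹ * (g * (x ^ 2 - 2 * algebraMap k K e * x + algebraMap k K c)) -
        algebraMap k K 1 = (algebraMap k K c * x⁻¹ - 2 * algebraMap k K e) * x⁻¹ := by
      rw [map_one]; field_simp; ring
    rw [this]
    exact hmul (sub_mem (mul_mem (P.const_mem c) ((P.ring.valuation_le_one_iff _).1 hinv.le))
      (mul_mem h2 (P.const_mem e))) hinv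
  fin_cases i
  · have : x⁻¹ ^ 2 * g⁻¹ * (g * (2 * η)) - algebraMap k K 0 = 2 * (η * x⁻¹ ^ 2) := by
      rw [map_zero]; field_simp; ring
    change P.ring.valuation (x⁻¹ ^ 2 * g⁻¹ * (g * (2 * η)) - algebraMap k K 0) < 1
    rw [this]
    refine hmul h2 ?_
    -- Squaring allows v(η)² = v(x)³ to be used: v(η / x²)² = v(x)⁻¹ < 1.
    rw [← pow_lt_one_iff_of_nonneg zero_le two_ne_zero, map_mul, mul_pow, P.valuation_sq heq hx,
      map_pow, map_inv₀]
    have hv0 : P.ring.valuation x ≠ 0 := (zero_lt_one.trans hx1).ne'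
    rw [map_inv₀] at hinv
    convert hinv using 1
    field_simp
  · exact hcoord _ _
  · exact hcoord _ _
  · exact hcoord _ _

end Place

theorem mainTheorem6 {k : Type*} [Field k] [DecidableEq k] (hk : (2 : k) ≠ 0)
    (E : WeierstrassCurve k) [E.IsElliptic]
    (f : Fin 4 → E.toAffine.FunctionField)
    (hf : Place.ProjectivelyNormal k f)
    (hO : Place.Subsheaf.Isomorphic (k := k) (Place.pullbackO1 f)
      (Place.sheafOfDivisor (E.multO 4)))
    (h2 : Nonempty (AddSubgroup.torsionBy E.toAffine.Point 2 ≃+ ZMod 2 × ZMod 2)) :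
    ∃ a b : k, a ≠ 0 ∧ b ≠ 0 ∧ a + b ≠ 0 ∧
      ∃ M : GL (Fin 4) k,
        (Place.imageIdeal k f).comap (linSubst M) = jacobiIdeal a b ∧
        ∀ O : Place k E.toAffine.FunctionField, E.IsBasePoint O →
          Place.MapsTo (Place.linTransform M f) O (jacobiIdentity k) := by
  obtain ⟨e₁, e₂, e₃, h₁₂, h₂₃, h₁₃, heq⟩ := E.exists_roots_of_two_torsion hk h2
  obtain ⟨g, hg0, hg⟩ := hO
  obtain ⟨B, hB⟩ := E.exists_linTransform_eq f hf hg0 hg heq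
  have h8 : (8 : k) ≠ 0 := by
    rw [show (8 : k) = 2 ^ 3 by norm_num]; exact pow_ne_zero 3 hk
  have hdet : (Place.jacobiMatrix e₁ e₂ e₃).det ≠ 0 := by
    rw [Place.det_jacobiMatrix]
    exact mul_ne_zero (mul_ne_zero (mul_ne_zero h8 h₁₂) h₂₃) h₁₃
  set N := Matrix.GeneralLinearGroup.mkOfDetNeZero _ hdet
  have hN : N.val = Place.jacobiMatrix e₁ e₂ e₃ := rfl
  -- `B` takes f to g⁻¹(1, x, η, x²) and `N` passes to Jacobi coordinates. The common factor g⁻¹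
  -- affects neither the ideal nor the image point.
  refine ⟨e₁ - e₂, e₂ - e₃, h₁₂, h₂₃, by rwa [sub_add_sub_cancel], N * B, ?_, fun O hO' => ?_⟩
  · rw [← Place.imageIdeal_linTransform, ← Place.linTransform_linTransform, hB,
      Place.linTransform_mul, Place.imageIdeal_mul (inv_ne_zero hg0),
      Place.imageIdeal_linTransform, Place.imageIdeal_eq_quarticIdeal heq
        fun p q => E.eq_zero_of_aeval_coordX_add_mul_coordEta,
      Place.comap_quarticIdeal hk h₁₂ h₂₃ h₁₃ N hN]
  · rw [← Place.linTransform_linTransform, hB]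
    exact O.mapsTo_jacobiIdentity heq hO' hN (inv_ne_zero hg0)
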